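/- Let $c,h,a\in\mathbb{C}$ with $c\neq 0$. For $h'\in\mathbb{C}$ let $L(c,h')$ be the irreducible quotient of the Verma module $M(c,h')$ of central charge $c$ and lowest weight $h'$ for the Virasoro algebra. Regard $L(c,0)$ as a vertex operator algebra in the standard way (the vacuum $\mathbf{1}$ is the lowest weight vector, the conformal vector is $\omega=L(-2)\mathbf{1}$, and $Y(\omega,x)=\sum_{n\in\mathbb{Z}}L(n)x^{-n-2}$), and let $h$ be such that $L(c,h)$ is an $L(c,0)$-module on which $Y(\omega,x)=\sum_{n\in\mathbb{Z}}L(n)x^{-n-2}$. Let $w_1$ be the lowest weight vector of $L(c,h)$, and let $\mathcal{Y}$ be a (possibly logarithmic) intertwining operator of type $\binom{L(c,0)}{L(c,h)\ L(c,h)}$, that is, a linear map $$\mathcal{Y}(\cdot,x):L(c,h)\to \mathrm{Hom}(L(c,h),L(c,0))\{x\}[\log x],\qquad \mathcal{Y}(w,x)=\sum_{i\ge 0}\sum_{\alpha\in\mathbb{C}}w^{(i)}_\alpha x^{-\alpha-1}(\log x)^i,$$ where $\{x\}$ denotes formal sums of arbitrary complex powers of $x$ and $\log x$ is a formal variable with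 $\frac{d}{dx}\log x=x^{-1}$, such that: for all $w,w'\in L(c,h)$ and $i\geq 0$ one has $w^{(i)}_\alpha w'=0$ when $\mathrm{Re}(\alpha)$ is large enough; $\mathcal{Y}(L(-1)w,x)=\frac{d}{dx}\mathcal{Y}(w,x)$; and $\mathcal{Y}$ satisfies the Jacobi identity with the vertex operators of $L(c,0)$ on $L(c,h)$ and on $L(c,0)$. Suppose that $\mathcal{Y}$ is normalized such that $$\mathcal{Y}(w_1,x)w_1=x^{-2h}\mathbf{1}+a\,x^{-2h+2}L(-2)\mathbf{1}+\cdots,$$ i.e. the coefficient of $x^{-2h}(\log x)^0$ is $\mathbf{1}$ and the coefficient of $x^{-2h+2}(\log x)^0$ is $a\,L(-2)\mathbf{1}$. Then $a=\dfrac{2h}{c}$. -/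

import Mathlib

noncomputable section

/-! ### The Virasoro Lie algebra -/

/-- The Virasoro Lie algebra `Vir = ⨁ₙ ℂ L(n) ⊕ ℂ C`: the first component holds the coordinates with
respect to the `L(n)`, the second one the coordinate with respect to the central element `C`. -/
def Vir : Type := (ℤ →₀ ℂ) × ℂ

namespace Vir

instance : AddCommGroup Vir := inferInstanceAs (AddCommGroup ((ℤ →₀ ℂ) × ℂ))

instance : Module ℂ Vir := inferInstanceAs (Module ℂ ((ℤ →₀ ℂ) × ℂ))

/-- The generator `L(n)`. -/
def L (n : ℤ) : Vir := (Finsupp.single n 1, 0)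

/-- The central element. -/
def C : Vir := (0, 1)

/-- The bracket of two generators,
`[L(m), L(n)] = (m - n) L(m + n) + ((m³ - m) / 12) δ_{m + n, 0} C`. -/
def genBracket (m n : ℤ) : Vir :=
  ((m : ℂ) - n) • L (m + n) + (if m + n = 0 then ((m : ℂ) ^ 3 - m) / 12 else 0) • C

/-- The bilinear extension of `genBracket`. -/
def bracketMap : (ℤ →₀ ℂ) →ₗ[ℂ] (ℤ →₀ ℂ) →ₗ[ℂ] Vir :=
  Finsupp.lift ((ℤ →₀ ℂ) →ₗ[ℂ] Vir) ℂ ℤ fun m => Finsupp.lift Vir ℂ ℤ (genBracket m)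

instance : Bracket Vir Vir := ⟨fun x y => bracketMap x.1 y.1⟩

theorem bracket_def (x y : Vir) : ⁅x, y⁆ = bracketMap x.1 y.1 := rfl

theorem bracketMap_single (m n : ℤ) (a b : ℂ) :
    bracketMap (Finsupp.single m a) (Finsupp.single n b) = a • b • genBracket m n := by
  simp [bracketMap]

@[simp] theorem fst_add (x y : Vir) : (x + y).1 = x.1 + y.1 := rfl

@[simp] theorem fst_smul (a : ℂ) (x : Vir) : (a • x).1 = a • x.1 := rfl

@[simp] theorem fst_zero : (0 : Vir).1 = 0 := rfl

@[simp] theorem snd_add (x y : Vir) : (x + y).2 = x.2 + y.2 := rfl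

@[simp] theorem snd_smul (a : ℂ) (x : Vir) : (a • x).2 = a * x.2 := rfl

@[simp] theorem snd_zero : (0 : Vir).2 = 0 := rfl

@[simp] theorem L_fst (n : ℤ) : (L n).1 = Finsupp.single n 1 := rfl

@[simp] theorem L_snd (n : ℤ) : (L n).2 = 0 := rfl

@[simp] theorem C_fst : C.1 = 0 := rfl

@[simp] theorem C_snd : C.2 = 1 := rfl

theorem genBracket_fst (m n : ℤ) :
    (genBracket m n).1 = Finsupp.single (m + n) ((m : ℂ) - n) := by
  simp only [genBracket]
  split_ifs <;> simp

theorem genBracket_snd (m n : ℤ) :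
    (genBracket m n).2 = if m + n = 0 then ((m : ℂ) ^ 3 - m) / 12 else 0 := by
  simp only [genBracket]
  split_ifs <;> simp

theorem genBracket_self (m : ℤ) : genBracket m m = 0 := by
  refine Prod.ext ?_ ?_
  · rw [genBracket_fst]; simp
  · rw [genBracket_snd]
    split_ifs with h
    · have : m = 0 := by omega
      simp [this]
    · rfl

theorem genBracket_skew (m n : ℤ) : genBracket m n + genBracket n m = 0 := by
  refine Prod.ext ?_ ?_
  · rw [fst_add, genBracket_fst, genBracket_fst, add_comm n m, ← Finsupp.single_add]
    simp
  · rw [snd_add, genBracket_snd, genBracket_snd, add_comm n m]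
    split_ifs with h
    · have : n = -m := by omega
      subst this
      push_cast
      simp only [snd_zero]
      ring
    · simp

theorem bracketMap_skew (f g : ℤ →₀ ℂ) : bracketMap f g + bracketMap g f = 0 := by
  induction f using Finsupp.induction_linear with
  | zero => simp
  | add f₁ f₂ h₁ h₂ =>
    simp only [map_add, LinearMap.add_apply]
    rw [← add_zero (0 : Vir)]
    nth_rewrite 1 [← h₁]
    rw [← h₂]
    abel
  | single m a =>
    induction g using Finsupp.induction_linear with
    | zero => simp
    | add g₁ g₂ h₁ h₂ =>
      simp only [map_add, LinearMap.add_apply]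
      rw [← add_zero (0 : Vir)]
      nth_rewrite 1 [← h₁]
      rw [← h₂]
      abel
    | single n b =>
      rw [bracketMap_single, bracketMap_single, smul_comm b a, ← smul_add, ← smul_add,
        genBracket_skew, smul_zero, smul_zero]

theorem bracketMap_self (f : ℤ →₀ ℂ) : bracketMap f f = 0 := by
  have h := bracketMap_skew f f
  rw [← two_smul ℂ] at h
  exact (smul_eq_zero.mp h).resolve_left two_ne_zero

theorem genBracket_jacobi (m n p : ℤ) :
    bracketMap (Finsupp.single m 1) (genBracket n p).1 =
      bracketMap (genBracket m n).1 (Finsupp.single p 1) +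
        bracketMap (Finsupp.single n 1) (genBracket m p).1 := by
  simp only [genBracket_fst, bracketMap_single, one_smul]
  refine Prod.ext ?_ ?_
  · simp only [fst_add, fst_smul, genBracket_fst, Finsupp.smul_single, smul_eq_mul]
    rw [show m + n + p = m + (n + p) by ring, show n + (m + p) = m + (n + p) by ring,
      ← Finsupp.single_add]
    congr 1
    push_cast
    ring
  · simp only [snd_add, snd_smul, genBracket_snd]
    rw [show m + n + p = m + (n + p) by ring, show n + (m + p) = m + (n + p) by ring]
    split_ifs with h
    · have : m = -(n + p) := by omega
      subst this
      push_cast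
      ring
    · simp

theorem bracketMap_jacobi (f g k : ℤ →₀ ℂ) :
    bracketMap f (bracketMap g k).1 =
      bracketMap (bracketMap f g).1 k + bracketMap g (bracketMap f k).1 := by
  induction f using Finsupp.induction_linear with
  | zero => simp
  | add f₁ f₂ h₁ h₂ =>
    simp only [map_add, LinearMap.add_apply, fst_add, h₁, h₂]
    abel
  | single m a =>
    induction g using Finsupp.induction_linear with
    | zero => simp
    | add g₁ g₂ h₁ h₂ =>
      simp only [map_add, LinearMap.add_apply, fst_add, h₁, h₂]
      abel
    | single n b =>
      induction k using Finsupp.induction_linear with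
      | zero => simp
      | add k₁ k₂ h₁ h₂ =>
        simp only [map_add, fst_add, h₁, h₂]
        abel
      | single p d =>
        have key := genBracket_jacobi m n p
        rw [← mul_one a, ← mul_one b, ← mul_one d, ← smul_eq_mul, ← smul_eq_mul, ← smul_eq_mul,
          ← Finsupp.smul_single, ← Finsupp.smul_single, ← Finsupp.smul_single]
        simp only [map_smul, LinearMap.smul_apply, fst_smul, bracketMap_single, one_smul]
        rw [key]
        simp only [smul_add]
        rw [smul_comm d a, smul_comm d b, smul_comm b a]
        congr 1
        all_goals (simp only [smul_smul]; congr 1; ring)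

instance : LieRing Vir where
  add_lie x y z := by simp [bracket_def]
  lie_add x y z := by simp [bracket_def]
  lie_self x := bracketMap_self x.1
  leibniz_lie x y z := bracketMap_jacobi x.1 y.1 z.1

instance : LieAlgebra ℂ Vir where
  lie_smul a x y := by simp [bracket_def]

/-- The universal enveloping algebra `U(Vir)`. -/
abbrev U : Type := UniversalEnvelopingAlgebra ℂ Vir

/-- `L(n)` as an element of `U(Vir)`. -/
def Lu (n : ℤ) : U := UniversalEnvelopingAlgebra.ι ℂ (L n)

/-- The central element as an element of `U(Vir)`. -/
def Cu : U := UniversalEnvelopingAlgebra.ι ℂ C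

/-! ### Verma modules and their irreducible quotients -/

/-- The left ideal of `U(Vir)` generated by `L(n)` for `n > 0`, `L(0) - h` and `C - c`. -/
def vermaIdeal (c h : ℂ) : Submodule U U :=
  Submodule.span U
    ({u | ∃ n : ℤ, 0 < n ∧ u = Lu n} ∪ {Lu 0 - algebraMap ℂ U h, Cu - algebraMap ℂ U c})

/-- The Verma module `M(c, h)` of central charge `c` and lowest weight `h`: the module induced from
the one-dimensional `Vir_{≥ 0}`-module on which `L(n)`, `n > 0`, acts by `0`, `L(0)` by `h` and
the central element by `c`. -/
abbrev Verma (c h : ℂ) : Type := U ⧸ vermaIdeal c h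

/-- The sum of all proper submodules of `M(c, h)`, that is, its maximal proper submodule. -/
def maxSubmodule (c h : ℂ) : Submodule U (Verma c h) := sSup {N | N ≠ ⊤}

/-- The irreducible quotient `L(c, h)` of the Verma module `M(c, h)`. -/
abbrev Irr (c h : ℂ) : Type := Verma c h ⧸ maxSubmodule c h

/-- The lowest weight vector of `L(c, h)`, the image of `1 ∈ U(Vir)`. -/
def Irr.lowest (c h : ℂ) : Irr c h :=
  Submodule.Quotient.mk (Submodule.Quotient.mk (1 : U))

/-- The operator by which `L(n)` acts on `L(c, h)`. -/
def Irr.op (c h : ℂ) (n : ℤ) : Module.End ℂ (Irr c h) := Algebra.lsmul ℂ ℂ (Irr c h) (Lu n)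

end Vir

/-! ### Vertex operator algebras, weak modules, logarithmic intertwining operators -/

/-- The `n`-th mode `A_n` of a vertex operator `A(x) = ∑ₙ A_n x^{-n-1}`. -/
abbrev mode {W : Type*} [AddCommGroup W] [Module ℂ W] (A : VertexOperator ℂ W) (n : ℤ) :
    Module.End ℂ W :=
  VertexOperator.ncoeff A n

/-- The Jacobi identity
`x₀⁻¹ δ((x₁ - x₂)/x₀) A₃(x₁) B(w₁, x₂) w₂ - x₀⁻¹ δ((x₂ - x₁)/(-x₀)) B(w₁, x₂) A₂(x₁) w₂
  = x₂⁻¹ δ((x₁ - x₀)/x₂) B(A₁(x₀) w₁, x₂) w₂`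
for `Aⱼ(x) = ∑ₙ Aⱼ(n) x^{-n-1}`, `n ∈ ℤ`, and `B(w, x) = ∑_α B(w, α) x^{-α-1}`, `α ∈ Γ`
(`Γ = ℤ` or `Γ = ℂ`). The displayed equation is the comparison of the coefficients of
`x₀^{-l-1} x₁^{-m-1} x₂^{-α-1}` on the two sides, every binomial being expanded in nonnegative
powers of its second variable. The sums over `i` have only finitely many nonzero terms as soon as
the `Aⱼ` and `B` satisfy the truncation property. -/
def JacobiIdentity {Γ W₁ W₂ W₃ : Type*} [AddCommGroupWithOne Γ]
    [AddCommGroup W₁] [AddCommGroup W₂] [AddCommGroup W₃]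
    (A₁ : ℤ → W₁ → W₁) (A₂ : ℤ → W₂ → W₂) (A₃ : ℤ → W₃ → W₃) (B : W₁ → Γ → W₂ → W₃) : Prop :=
  ∀ (l m : ℤ) (α : Γ) (w₁ : W₁) (w₂ : W₂),
    ∑ᶠ i : ℕ, ((-1) ^ i * Ring.choose l i) •
        (A₃ (m + l - i) (B w₁ (α + i) w₂) -
          (l.negOnePow : ℤ) • B w₁ (α + l - i) (A₂ (m + i) w₂)) =
      ∑ᶠ i : ℕ, Ring.choose m i • B (A₁ (l + i) w₁) (α + m - i) w₂

/-- The structure of a vertex operator algebra on a complex vector space `V`. The vertex operator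
`Y(v, x) = ∑ₙ vₙ x^{-n-1}` has the modes `vₙ = mode (Y v) n`; the type `VertexOperator` contains the
truncation property `vₙ w = 0` for `n` large. The operators of the Virasoro algebra are
`L(n) = ω_{n+1}`. -/
structure VertexOperatorAlgebra (V : Type*) [AddCommGroup V] [Module ℂ V] where
  Y : V →ₗ[ℂ] VertexOperator ℂ V
  vac : V
  conf : V
  rank : ℂ
  grading : ℤ → Submodule ℂ V
  grading_internal : DirectSum.IsInternal grading
  grading_finite : ∀ n, FiniteDimensional ℂ (grading n)
  grading_bounded : ∃ N : ℤ, ∀ n < N, grading n = ⊥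
  vacuum : ∀ n : ℤ, mode (Y vac) n = if n = -1 then LinearMap.id else 0
  creation_nonneg : ∀ (v : V) (n : ℤ), 0 ≤ n → mode (Y v) n vac = 0
  creation : ∀ v : V, mode (Y v) (-1) vac = v
  jacobi : ∀ u : V, JacobiIdentity (fun n v => mode (Y u) n v) (fun n v => mode (Y u) n v)
    (fun n v => mode (Y u) n v) (fun v (n : ℤ) w => mode (Y v) n w)
  virasoro : ∀ (m n : ℤ) (v : V),
    mode (Y conf) (m + 1) (mode (Y conf) (n + 1) v) -
        mode (Y conf) (n + 1) (mode (Y conf) (m + 1) v) =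
      ((m : ℂ) - n) • mode (Y conf) (m + n + 1) v +
        (if m + n = 0 then ((m : ℂ) ^ 3 - m) / 12 * rank else 0) • v
  weight : ∀ (n : ℤ), ∀ v ∈ grading n, mode (Y conf) 1 v = (n : ℂ) • v
  derivative : ∀ (v : V) (n : ℤ), mode (Y (mode (Y conf) 0 v)) n = (-n : ℂ) • mode (Y v) (n - 1)

/-- The structure of a weak module on `W` for a vertex operator algebra: all axioms of a module
except for those on the grading and the action of `L(0)`. -/
structure VertexOperatorAlgebra.WeakModule {V : Type*} [AddCommGroup V] [Module ℂ V]
    (𝒱 : VertexOperatorAlgebra V) (W : Type*) [AddCommGroup W] [Module ℂ W] where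
  Y : V →ₗ[ℂ] VertexOperator ℂ W
  vacuum : ∀ n : ℤ, mode (Y 𝒱.vac) n = if n = -1 then LinearMap.id else 0
  jacobi : ∀ u : V, JacobiIdentity (fun n v => mode (𝒱.Y u) n v) (fun n w => mode (Y u) n w)
    (fun n w => mode (Y u) n w) (fun v (n : ℤ) w => mode (Y v) n w)
  virasoro : ∀ (m n : ℤ) (w : W),
    mode (Y 𝒱.conf) (m + 1) (mode (Y 𝒱.conf) (n + 1) w) -
        mode (Y 𝒱.conf) (n + 1) (mode (Y 𝒱.conf) (m + 1) w) =
      ((m : ℂ) - n) • mode (Y 𝒱.conf) (m + n + 1) w +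
        (if m + n = 0 then ((m : ℂ) ^ 3 - m) / 12 * 𝒱.rank else 0) • w
  derivative : ∀ (v : V) (n : ℤ), mode (Y (mode (𝒱.Y 𝒱.conf) 0 v)) n = (-n : ℂ) • mode (Y v) (n - 1)

/-- A vertex operator algebra as a weak module for itself. -/
def VertexOperatorAlgebra.adjoint {V : Type*} [AddCommGroup V] [Module ℂ V]
    (𝒱 : VertexOperatorAlgebra V) : 𝒱.WeakModule V where
  Y := 𝒱.Y
  vacuum := 𝒱.vacuum
  jacobi := 𝒱.jacobi
  virasoro := 𝒱.virasoro
  derivative := 𝒱.derivative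

/-- The space `M{x}[log x]` of polynomials in the formal variable `log x` whose coefficients are
formal sums `∑_{r ∈ ℂ} a_r x^r`, `a_r ∈ M`: the value of `f : LogSeries M` at `i : ℕ` and `r : ℂ`
is the coefficient of `x^r (log x)^i`. -/
abbrev LogSeries (M : Type*) [AddCommGroup M] : Type _ := ℕ →₀ (ℂ → M)

/-- Logarithmic intertwining operators of type `(W₃ over W₁ W₂)`: linear maps
`𝒴(·, x) : W₁ → Hom(W₂, W₃){x}[log x]`,
`𝒴(w, x) = ∑_{i ≥ 0} ∑_{α ∈ ℂ} w^{(i)}_α x^{-α-1} (log x)^i`, with the truncation property, the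
`L(-1)`-derivative property `𝒴(L(-1) w, x) = (d/dx) 𝒴(w, x)`, where `(d/dx) log x = x⁻¹`, and the
Jacobi identity, compared for every power of `log x₂` separately. -/
structure LogIntertwiner {V W₁ W₂ W₃ : Type*} [AddCommGroup V] [Module ℂ V]
    [AddCommGroup W₁] [Module ℂ W₁] [AddCommGroup W₂] [Module ℂ W₂] [AddCommGroup W₃] [Module ℂ W₃]
    {𝒱 : VertexOperatorAlgebra V}
    (M₁ : 𝒱.WeakModule W₁) (M₂ : 𝒱.WeakModule W₂) (M₃ : 𝒱.WeakModule W₃) where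
  Y : W₁ →ₗ[ℂ] LogSeries (W₂ →ₗ[ℂ] W₃)
  truncation : ∀ (w₁ : W₁) (w₂ : W₂) (i : ℕ), ∃ R : ℝ, ∀ α : ℂ, R ≤ α.re →
    Y w₁ i (-α - 1) w₂ = 0
  derivative : ∀ (w₁ : W₁) (i : ℕ) (r : ℂ),
    Y (mode (M₁.Y 𝒱.conf) 0 w₁) i r =
      (r + 1) • Y w₁ i (r + 1) + ((i : ℂ) + 1) • Y w₁ (i + 1) (r + 1)
  jacobi : ∀ (u : V) (i : ℕ),
    JacobiIdentity (fun n w => mode (M₁.Y u) n w) (fun n w => mode (M₂.Y u) n w)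
      (fun n w => mode (M₃.Y u) n w) (fun w₁ (α : ℂ) w₂ => Y w₁ i (-α - 1) w₂)

/-! ### The vertex operator algebra `L(c, 0)` and its modules `L(c, h)` -/

/-- `𝒱` is the standard vertex operator algebra structure on `L(c, 0)`: its rank is `c`, its vacuum
`𝟏` is the lowest weight vector, its conformal vector is `L(-2) 𝟏`, and
`Y(ω, x) = ∑ₙ L(n) x^{-n-2}` for the given action of the Virasoro algebra on `L(c, 0)`. -/
structure IsVirasoroVOA {c : ℂ} (𝒱 : VertexOperatorAlgebra (Vir.Irr c 0)) : Prop where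
  rank_eq : 𝒱.rank = c
  vac_eq : 𝒱.vac = Vir.Irr.lowest c 0
  conf_eq : 𝒱.conf = Vir.Irr.op c 0 (-2) (Vir.Irr.lowest c 0)
  mode_eq : ∀ n : ℤ, mode (𝒱.Y 𝒱.conf) (n + 1) = Vir.Irr.op c 0 n

/-- `M` is the standard `L(c, 0)`-module structure on `L(c, h)`: the operators `L(n)` coming from
the conformal vector are those of the given action of the Virasoro algebra on `L(c, h)`. -/
def IsVirasoroModule {c h : ℂ} {𝒱 : VertexOperatorAlgebra (Vir.Irr c 0)}
    (M : 𝒱.WeakModule (Vir.Irr c h)) : Prop :=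
  ∀ n : ℤ, mode (M.Y 𝒱.conf) (n + 1) = Vir.Irr.op c h n

end

/-!
The value of `a` comes from two instances of the commutator formula, applied to the coefficients
`f i r` of `x^r (log x)^i` in `𝒴(w₁, x) w₁`. Bracketing with `L(0)` and using the
`L(-1)`-derivative property gives `(L(0) - 2h - r) f i r = (i + 1) f (i + 1) r`. At `r = -2h` and
`i = 0`, where `f 0 (-2h) = 𝟏` has weight `0`, this shows that `𝒴(w₁, x) w₁` has no term
`x^{-2h} log x`. Bracketing with `L(2)` and comparing the coefficients of `x^{-2h}` then gives
`L(2) (a L(-2) 𝟏) = (-2h + 3h) 𝟏`, whereas `L(2) L(-2) 𝟏 = (c / 2) 𝟏`. Hence `a c / 2 = h`, provided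
that `𝟏` is nonzero in `L(c, 0)`.

That `𝟏 ≠ 0` has two parts.

* The lowest weight vector of `M(c, 0)` is nonzero (`Vir.one_notMem_vermaIdeal`), because the Fock
  space `ℂ[x₁, x₂, …]` of one free boson with a background charge `t` is a representation of central
  charge `1 - 12 t²`, an arbitrary complex number, whose vacuum satisfies the defining relations of
  the lowest weight vector. The Virasoro relations hold on the Fock space because an operator that
  commutes with the Heisenberg algebra is a scalar determined by its vacuum expectation
  (`HeisenbergFock.eq_smul_of_commute`).
* The lowest weight vector of `M(c, h)` is not in the sum of the proper submodules
  (`Vir.Irr.lowest_ne_zero`), because polynomials in `L(0)` separate the lowest weight from the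
  others, so that every proper submodule lies in the sum of the higher weight spaces.
-/

noncomputable section

/-! ### The Fock space of a free boson with a background charge -/

namespace HeisenbergFock

open MvPolynomial

/-- The modes of the Heisenberg algebra on the Fock space `ℂ[x₁, x₂, …]` of charge `0`, with the
variable `x_{k+1}` encoded as `X k`: the mode `a n` is `n ∂/∂xₙ` for `n > 0`, `0` for `n = 0` and
multiplication by `x₋ₙ` for `n < 0`. -/
def a : ℤ → Module.End ℂ (MvPolynomial ℕ ℂ)
  | Int.ofNat k => (k : ℂ) • (pderiv (k - 1)).toLinearMap
  | Int.negSucc k => LinearMap.mulLeft ℂ (X k)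

theorem a_ofNat (k : ℕ) (v : MvPolynomial ℕ ℂ) : a (k : ℤ) v = (k : ℂ) • pderiv (k - 1) v := rfl

theorem a_negSucc (k : ℕ) (v : MvPolynomial ℕ ℂ) : a (Int.negSucc k) v = X k * v := rfl

theorem pderiv_comm (i j : ℕ) (v : MvPolynomial ℕ ℂ) :
    pderiv i (pderiv j v) = pderiv j (pderiv i v) := by
  have h : ⁅(pderiv i : Derivation ℂ (MvPolynomial ℕ ℂ) (MvPolynomial ℕ ℂ)),
      (pderiv j : Derivation ℂ (MvPolynomial ℕ ℂ) (MvPolynomial ℕ ℂ))⁆ = 0 := by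
    apply MvPolynomial.derivation_ext
    intro k
    simp only [Derivation.commutator_apply, pderiv_X, Derivation.coe_zero, Pi.zero_apply]
    by_cases hi : i = k <;> by_cases hj : j = k <;> simp [hi, hj]
  have := congrArg (fun D => D v) h
  simpa [Derivation.commutator_apply, sub_eq_zero] using this

theorem a_ofNat_negSucc (k l : ℕ) (v : MvPolynomial ℕ ℂ) :
    a (k : ℤ) (a (Int.negSucc l) v) - a (Int.negSucc l) (a (k : ℤ) v) =
      if k = l + 1 then (k : ℂ) • v else 0 := by
  simp only [a_ofNat, a_negSucc, Derivation.leibniz, pderiv_X, smul_eq_mul]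
  rcases k with _ | k
  · simp
  · by_cases h : k = l
    · subst h
      simp [smul_add]
    · simp [h, Ne.symm h]

/-- The Heisenberg relations. -/
theorem a_comm (m n : ℤ) (v : MvPolynomial ℕ ℂ) :
    a m (a n v) - a n (a m v) = if m + n = 0 then (m : ℂ) • v else 0 := by
  rcases m with k | k <;> rcases n with l | l
  · simp only [Int.ofNat_eq_natCast, a_ofNat, map_smul, pderiv_comm (k - 1) (l - 1)]
    rw [smul_comm, sub_self]
    split_ifs with h
    · have : k = 0 := by omega
      simp [this]
    · rfl
  · rw [Int.ofNat_eq_natCast, a_ofNat_negSucc]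
    simp only [show (k : ℤ) + Int.negSucc l = 0 ↔ k = l + 1 by omega, Int.cast_natCast]
  · rw [← neg_sub, Int.ofNat_eq_natCast, a_ofNat_negSucc]
    simp only [show Int.negSucc k + (l : ℤ) = 0 ↔ l = k + 1 by omega]
    split_ifs with h
    · subst h
      rw [← neg_smul]
      congr 1
      push_cast
      ring
    · simp
  · rw [if_neg (by omega)]
    simp only [a_negSucc]
    ring

theorem a_apply_comm (m n : ℤ) (v : MvPolynomial ℕ ℂ) :
    a m (a n v) = a n (a m v) + if m + n = 0 then (m : ℂ) • v else 0 := by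
  rw [← a_comm, add_sub_cancel]

theorem exists_a_eq_zero (v : MvPolynomial ℕ ℂ) : ∃ N : ℤ, ∀ n, N ≤ n → a n v = 0 := by
  obtain ⟨N, hN⟩ := v.vars.exists_nat_subset_range
  refine ⟨N + 1, fun n hn => ?_⟩
  lift n to ℕ using by omega
  rw [a_ofNat, pderiv_eq_zero_of_notMem_vars, smul_zero]
  intro h
  have := Finset.mem_range.1 (hN h)
  omega

theorem a_one (n : ℤ) (hn : 0 ≤ n) : a n 1 = 0 := by
  lift n to ℕ using hn
  simp [a_ofNat]

theorem constantCoeff_a (n : ℤ) (hn : n ≤ 0) (v : MvPolynomial ℕ ℂ) :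
    constantCoeff (a n v) = 0 := by
  rcases n with k | k
  · have : k = 0 := by simpa using hn
    subst this
    rw [Int.ofNat_eq_natCast, a_ofNat, Nat.cast_zero, zero_smul, map_zero]
  · simp [a_negSucc]

/-- A vector annihilated by all positive modes is a multiple of the vacuum. -/
theorem eq_C_of_a_eq_zero (v : MvPolynomial ℕ ℂ) (hv : ∀ n : ℤ, 0 < n → a n v = 0) :
    v = C (constantCoeff v) := by
  ext m
  rw [coeff_C]
  split_ifs with h
  · rw [← h]; rfl
  · obtain ⟨i, hi⟩ : ∃ i, m i ≠ 0 := by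
      by_contra! h'
      exact h (Finsupp.ext h').symm
    have h1 := hv ((i + 1 : ℕ) : ℤ) (by positivity)
    rw [a_ofNat, smul_eq_zero, or_iff_right (Nat.cast_ne_zero.2 i.succ_ne_zero)] at h1
    have h2 := congrArg (coeff (m - Finsupp.single i 1)) h1
    rw [Nat.add_sub_cancel, coeff_pderiv, coeff_zero] at h2
    have h3 : m - Finsupp.single i 1 + Finsupp.single i 1 = m :=
      tsub_add_cancel_of_le (by simpa [Nat.one_le_iff_ne_zero] using hi)
    rw [h3] at h2
    refine (mul_eq_zero.1 h2).resolve_right (Nat.cast_add_one_ne_zero _)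

/-- An operator which commutes with the Heisenberg algebra is determined by its value at the
vacuum. -/
theorem eq_smul_of_commute (D : Module.End ℂ (MvPolynomial ℕ ℂ))
    (hD : ∀ j v, D (a j v) = a j (D v)) (κ : ℂ) (h1 : constantCoeff (D 1) = κ)
    (v : MvPolynomial ℕ ℂ) : D v = κ • v := by
  have hv : D 1 = κ • 1 := by
    rw [eq_C_of_a_eq_zero (D 1) fun n hn => by rw [← hD, a_one n hn.le, map_zero], h1,
      smul_eq_C_mul, mul_one]
  induction v using MvPolynomial.induction_on with
  | C r => rw [C_eq_smul_one, map_smul, hv, smul_comm]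
  | add p q hp hq => rw [map_add, hp, hq, smul_add]
  | mul_X p i hp =>
    rw [mul_comm, ← a_negSucc, hD, hp, map_smul]

/-- The normally ordered product `:a k a l:`: the mode of larger index acts first. -/
def nord (k l : ℤ) : Module.End ℂ (MvPolynomial ℕ ℂ) := if k ≤ l then a k * a l else a l * a k

theorem nord_comm (k l j : ℤ) (v : MvPolynomial ℕ ℂ) :
    nord k l (a j v) - a j (nord k l v) =
      (if k + j = 0 then (k : ℂ) • a l v else 0) + if l + j = 0 then (l : ℂ) • a k v else 0 := by
  unfold nord
  split_ifs with h <;> simp only [Module.End.mul_apply]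
  all_goals
    simp only [a_apply_comm _ j, map_add, *, if_true, if_false, map_smul, map_zero]
    abel

theorem finite_support_nord (n : ℤ) (v : MvPolynomial ℕ ℂ) :
    (Function.support fun k => nord k (n - k) v).Finite := by
  obtain ⟨N, hN⟩ := exists_a_eq_zero v
  refine (Set.finite_Icc (n - N) N).subset fun k hk => ?_
  rw [Function.mem_support] at hk
  contrapose! hk
  rw [Set.mem_Icc] at hk
  unfold nord
  split_ifs with h <;> simp only [Module.End.mul_apply] <;> rw [hN _ (by omega), map_zero]

/-- The operators `∑ₖ :a k a (n - k):`, summed over `k ∈ ℤ`. Only finitely many summands are nonzero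
on a given vector. -/
def quad (n : ℤ) : Module.End ℂ (MvPolynomial ℕ ℂ) where
  toFun v := ∑ᶠ k, nord k (n - k) v
  map_add' v w := by
    simp only [map_add]
    exact finsum_add_distrib (finite_support_nord n v) (finite_support_nord n w)
  map_smul' t v := by
    simp only [map_smul, RingHom.id_apply, smul_finsum]

theorem quad_apply (n : ℤ) (v : MvPolynomial ℕ ℂ) : quad n v = ∑ᶠ k, nord k (n - k) v := rfl

theorem quad_comm (n j : ℤ) (v : MvPolynomial ℕ ℂ) :
    quad n (a j v) - a j (quad n v) = (-2 * j : ℂ) • a (n + j) v := by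
  have h1 : a j (quad n v) = ∑ᶠ k, a j (nord k (n - k) v) :=
    (a j).toAddMonoidHom.map_finsum (finite_support_nord n v)
  have hf : (Function.support fun k => a j (nord k (n - k) v)).Finite :=
    (finite_support_nord n v).subset fun k hk => by
      rw [Function.mem_support] at hk ⊢
      contrapose! hk
      rw [hk, map_zero]
  rw [h1, quad_apply, ← finsum_sub_distrib (finite_support_nord n _) hf]
  simp only [nord_comm]
  rw [finsum_add_distrib, finsum_eq_single _ (-j), finsum_eq_single _ (n + j)]
  · rw [if_pos (by ring), if_pos (by ring), sub_neg_eq_add, sub_add_cancel_left, ← add_smul]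
    congr 1
    push_cast
    ring
  · intro k hk
    rw [if_neg (by omega)]
  · intro k hk
    rw [if_neg (by omega)]
  · refine (Set.finite_singleton (-j)).subset fun k hk => ?_
    by_contra h
    exact hk (if_neg (by simp at h; omega))
  · refine (Set.finite_singleton (n + j)).subset fun k hk => ?_
    by_contra h
    exact hk (if_neg (by simp at h; omega))

/-- The Virasoro operators on the Fock space with the background charge `t`,
`½ ∑ₖ :a k a (n - k): + t (n + 1) a n`. With this choice of the linear term all operators of index
at least `-1` annihilate the vacuum, so that its weight is `0` for every `t`. -/
def op (t : ℂ) (n : ℤ) : Module.End ℂ (MvPolynomial ℕ ℂ) :=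
  (1 / 2 : ℂ) • quad n + (t * (n + 1)) • a n


theorem op_apply (t : ℂ) (n : ℤ) (v : MvPolynomial ℕ ℂ) :
    op t n v = (1 / 2 : ℂ) • quad n v + (t * (n + 1)) • a n v := rfl

/-- The commutator `[L(n), a j] = -j a (n + j) + t n (n + 1) δ_{n + j, 0}`. -/
theorem op_a (t : ℂ) (n j : ℤ) (v : MvPolynomial ℕ ℂ) :
    op t n (a j v) = a j (op t n v) - (j : ℂ) • a (n + j) v +
      if n + j = 0 then (t * (n + 1) * n) • v else 0 := by
  have h : quad n (a j v) = a j (quad n v) + (-2 * j : ℂ) • a (n + j) v := by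
    rw [← quad_comm, add_sub_cancel]
  simp only [op_apply, h, a_apply_comm n j, map_add, map_smul, smul_add]
  split_ifs
  · module
  · module

theorem nord_one (k l : ℤ) (h : 0 ≤ k ∨ 0 ≤ l) : nord k l 1 = 0 := by
  unfold nord
  split_ifs <;> simp only [Module.End.mul_apply] <;> rw [a_one _ (by omega), map_zero]

theorem op_one (t : ℂ) (n : ℤ) (hn : 0 ≤ n) : op t n 1 = 0 := by
  rw [op_apply, a_one n hn, quad_apply, finsum_eq_zero_of_forall_eq_zero, smul_zero, smul_zero,
    add_zero]
  exact fun k => nord_one _ _ (by omega)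

theorem constantCoeff_op (t : ℂ) (n : ℤ) (hn : n ≤ 0) (v : MvPolynomial ℕ ℂ) :
    constantCoeff (op t n v) = 0 := by
  have h : constantCoeff (quad n v) = ∑ᶠ k, constantCoeff (nord k (n - k) v) :=
    (constantCoeff (R := ℂ) (σ := ℕ)).toAddMonoidHom.map_finsum (finite_support_nord n v)
  rw [op_apply, map_add, constantCoeff_smul, constantCoeff_smul, constantCoeff_a n hn, h,
    finsum_eq_zero_of_forall_eq_zero, smul_zero, smul_zero, add_zero]
  intro k
  unfold nord
  split_ifs <;> simp only [Module.End.mul_apply] <;> exact constantCoeff_a _ (by omega) _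

theorem constantCoeff_op_a_a (t : ℂ) (m k l : ℤ) (hk : k < 0) (hl : l < 0) :
    constantCoeff (op t m (a k (a l 1))) = if m + k + l = 0 then (k : ℂ) * l else 0 := by
  rw [op_a, map_add, map_sub, constantCoeff_a k hk.le, constantCoeff_smul, a_apply_comm (m + k) l,
    map_add, constantCoeff_a l hl.le]
  have h0 : constantCoeff (if m + k = 0 then (t * (m + 1) * m) • a l 1 else 0) = 0 := by
    split_ifs
    · rw [constantCoeff_smul, constantCoeff_a l hl.le, smul_zero]
    · exact map_zero _
  rw [h0]
  split_ifs with h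
  · have : m = -k - l := by omega
    subst this
    simp
    ring
  · simp

theorem constantCoeff_op_nord (t : ℂ) (m k l : ℤ) (hk : k < 0) (hl : l < 0) :
    constantCoeff (op t m (nord k l 1)) = if m + k + l = 0 then (k : ℂ) * l else 0 := by
  unfold nord
  split_ifs with h h' h' <;> simp only [Module.End.mul_apply]
  · rw [constantCoeff_op_a_a t m k l hk hl, if_pos h']
  · rw [constantCoeff_op_a_a t m k l hk hl, if_neg h']
  · rw [constantCoeff_op_a_a t m l k hl hk, if_pos (by omega), mul_comm]
  · rw [constantCoeff_op_a_a t m l k hl hk, if_neg (by omega)]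

theorem sum_range_mul_sub (q : ℂ) (n : ℕ) :
    ∑ i ∈ Finset.range n, (i : ℂ) * (q - i) =
      q * (n * (n - 1) / 2) - n * (n - 1) * (2 * n - 1) / 6 := by
  induction n with
  | zero => simp
  | succ n ih =>
    rw [Finset.sum_range_succ, ih]
    push_cast
    ring

theorem constantCoeff_op_quad (t : ℂ) (m : ℤ) (p : ℕ) :
    constantCoeff (op t m (quad (-p) 1)) = if m = p then ((p : ℂ) ^ 3 - p) / 6 else 0 := by
  have h1 : constantCoeff (op t m (quad (-p) 1)) =
      ∑ᶠ k, constantCoeff (op t m (nord k (-p - k) 1)) :=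
    ((constantCoeff (R := ℂ) (σ := ℕ)).toAddMonoidHom.comp (op t m).toAddMonoidHom).map_finsum
      (finite_support_nord (-p) 1)
  rw [h1, finsum_eq_sum_of_support_subset (s := (Finset.range p).map
    (Nat.castEmbedding.trans (Equiv.neg ℤ).toEmbedding)), Finset.sum_map]
  · have h2 : ∀ i ∈ Finset.range p,
        constantCoeff (op t m (nord (-i) (-p - (-i)) 1)) =
          if m = p then (i : ℂ) * (p - i) else 0 := by
      intro i hi
      rw [Finset.mem_range] at hi
      rcases Nat.eq_zero_or_pos i with rfl | hi0
      · rw [nord_one _ _ (by simp)]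
        simp
      · rw [constantCoeff_op_nord _ _ _ _ (by omega) (by omega)]
        simp only [show m + -(i : ℤ) + (-p - -i) = 0 ↔ m = p by omega]
        push_cast
        congr 1
        ring
    refine (Finset.sum_congr rfl h2).trans ?_
    split_ifs
    · rw [sum_range_mul_sub]
      ring
    · simp
  · intro k hk
    rw [Function.mem_support] at hk
    have h3 : k < 0 ∧ -(p : ℤ) - k < 0 := by
      by_contra h
      exact hk (by rw [nord_one _ _ (by omega), map_zero, map_zero])
    simp only [Finset.coe_map, Set.mem_image, Finset.mem_coe, Finset.mem_range]
    refine ⟨(-k).toNat, by omega, ?_⟩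
    simp
    omega

theorem constantCoeff_op_op (t : ℂ) (m : ℤ) (p : ℕ) (hp : 0 < p) :
    constantCoeff (op t m (op t (-p) 1)) =
      if m = p then ((p : ℂ) ^ 3 - p) / 12 * (1 - 12 * t ^ 2) else 0 := by
  have h0 : ∀ n : ℤ, constantCoeff (a n 1) = 0 := fun n => by
    rcases le_total 0 n with h | h
    · rw [a_one n h, map_zero]
    · exact constantCoeff_a n h 1
  rw [op_apply t (-p), map_add, map_smul, map_smul, map_add, constantCoeff_smul,
    constantCoeff_smul, constantCoeff_op_quad, op_a, map_add, map_sub, constantCoeff_a _ (by omega),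
    constantCoeff_smul, h0]
  simp only [show m + -(p : ℤ) = 0 ↔ m = p by omega]
  split_ifs with h
  · subst h
    simp
    ring
  · simp

/-- The vacuum expectation of `[L(m), L(n)]` is the central term. -/
theorem constantCoeff_commutator (t : ℂ) (m n : ℤ) :
    constantCoeff (op t m (op t n 1)) - constantCoeff (op t n (op t m 1)) =
      if m + n = 0 then ((m : ℂ) ^ 3 - m) / 12 * (1 - 12 * t ^ 2) else 0 := by
  rcases le_or_gt 0 m with hm | hm <;> rcases le_or_gt 0 n with hn | hn
  · rw [op_one t m hm, op_one t n hn]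
    split_ifs with h
    · have : m = 0 := by omega
      simp [this]
    · simp
  · obtain ⟨p, rfl⟩ : ∃ p : ℕ, n = -p := ⟨n.natAbs, by omega⟩
    rw [op_one t m hm, map_zero, map_zero, sub_zero, constantCoeff_op_op t m p (by omega)]
    simp only [show m + -(p : ℤ) = 0 ↔ m = p by omega]
    split_ifs with h
    · subst h; simp
    · rfl
  · obtain ⟨p, rfl⟩ : ∃ p : ℕ, m = -p := ⟨m.natAbs, by omega⟩
    rw [op_one t n hn, map_zero, map_zero, zero_sub, constantCoeff_op_op t n p (by omega)]
    simp only [show -(p : ℤ) + n = 0 ↔ n = p by omega]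
    split_ifs with h
    · subst h; push_cast; ring
    · simp
  · rw [constantCoeff_op t m hm.le, constantCoeff_op t n hn.le, if_neg (by omega), sub_zero]

/-- The Virasoro relations, with the central charge `1 - 12 t²`. The difference of the two sides
without the central term commutes with the Heisenberg algebra, so that it is a scalar, and the
scalar is read off at the vacuum. -/
theorem op_comm (t : ℂ) (m n : ℤ) (v : MvPolynomial ℕ ℂ) :
    op t m (op t n v) - op t n (op t m v) = ((m : ℂ) - n) • op t (m + n) v +
      (if m + n = 0 then ((m : ℂ) ^ 3 - m) / 12 * (1 - 12 * t ^ 2) else 0) • v := by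
  have key := eq_smul_of_commute
    (op t m * op t n - op t n * op t m - ((m : ℂ) - n) • op t (m + n)) ?_
    (if m + n = 0 then ((m : ℂ) ^ 3 - m) / 12 * (1 - 12 * t ^ 2) else 0) ?_ v
  · rw [← key]
    simp
  · intro j v
    -- With a background charge, the scalar terms of `[L(n), a j]` enter when `m + n + j = 0`.
    have e1 : n + (m + j) = m + (n + j) := by ring
    simp only [LinearMap.sub_apply, Module.End.mul_apply, LinearMap.smul_apply, op_a, map_add,
      map_sub, map_smul, e1, add_assoc]
    by_cases h : m + (n + j) = 0
    · have hj : (j : ℂ) = -m - n := by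
        have : j = -m - n := by omega
        rw [this]; push_cast; ring
      split_ifs <;> simp only [map_smul, map_zero, hj] <;> push_cast <;> rw [hj] <;> module
    · split_ifs <;> simp only [map_smul, map_zero] <;> push_cast <;> module
  · simp only [LinearMap.sub_apply, Module.End.mul_apply, LinearMap.smul_apply, map_sub,
      constantCoeff_smul, constantCoeff_commutator]
    have h0 : constantCoeff (op t (m + n) 1) = 0 := by
      rcases le_total 0 (m + n) with h | h
      · rw [op_one t _ h, map_zero]
      · exact constantCoeff_op t _ h 1
    rw [h0, smul_zero, sub_zero]

end HeisenbergFock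

/-! ### The Fock space as a representation of the Virasoro algebra -/

namespace Vir

attribute [local instance] LieRing.ofAssociativeRing

/-- The linear map underlying `fockRep`. -/
def fockMap (t : ℂ) : Vir →ₗ[ℂ] Module.End ℂ (MvPolynomial ℕ ℂ) where
  toFun x := Finsupp.linearCombination ℂ (HeisenbergFock.op t) x.1 +
    (x.2 * (1 - 12 * t ^ 2)) • (1 : Module.End ℂ (MvPolynomial ℕ ℂ))
  map_add' x y := by
    simp only [fst_add, snd_add, map_add, add_mul, add_smul]
    abel
  map_smul' r x := by
    simp only [fst_smul, snd_smul, map_smul, smul_add, smul_smul, mul_assoc, RingHom.id_apply]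

theorem fockMap_apply (t : ℂ) (x : Vir) :
    fockMap t x = Finsupp.linearCombination ℂ (HeisenbergFock.op t) x.1 +
      (x.2 * (1 - 12 * t ^ 2)) • (1 : Module.End ℂ (MvPolynomial ℕ ℂ)) := rfl

theorem fockMap_genBracket (t : ℂ) (m n : ℤ) :
    fockMap t (genBracket m n) = ⁅HeisenbergFock.op t m, HeisenbergFock.op t n⁆ := by
  rw [fockMap_apply, genBracket_fst, genBracket_snd, Finsupp.linearCombination_single]
  refine LinearMap.ext fun v => ?_
  rw [LieRing.of_associative_ring_bracket, LinearMap.sub_apply, Module.End.mul_apply,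
    Module.End.mul_apply, HeisenbergFock.op_comm, LinearMap.add_apply, LinearMap.smul_apply,
    LinearMap.smul_apply, Module.End.one_apply, ite_mul, zero_mul]

theorem fockMap_bracketMap (t : ℂ) (f g : ℤ →₀ ℂ) :
    fockMap t (bracketMap f g) =
      ⁅Finsupp.linearCombination ℂ (HeisenbergFock.op t) f,
        Finsupp.linearCombination ℂ (HeisenbergFock.op t) g⁆ := by
  induction f using Finsupp.induction_linear with
  | zero => simp
  | add f₁ f₂ h₁ h₂ => simp only [map_add, LinearMap.add_apply, h₁, h₂, add_lie]
  | single m a =>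
    induction g using Finsupp.induction_linear with
    | zero => simp
    | add g₁ g₂ h₁ h₂ => simp only [map_add, h₁, h₂, lie_add]
    | single n b =>
      simp only [bracketMap_single, Finsupp.linearCombination_single, map_smul,
        fockMap_genBracket, smul_lie, lie_smul, smul_comm b a]

/-- The Fock space with background charge `t` as a representation of the Virasoro algebra, of
central charge `1 - 12 t²`. -/
def fockRep (t : ℂ) : Vir →ₗ⁅ℂ⁆ Module.End ℂ (MvPolynomial ℕ ℂ) :=
  { fockMap t with
    map_lie' := fun {x y} => by
      change fockMap t ⁅x, y⁆ = ⁅fockMap t x, fockMap t y⁆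
      rw [bracket_def, fockMap_bracketMap, fockMap_apply, fockMap_apply]
      simp only [LieRing.of_associative_ring_bracket, mul_add, add_mul, mul_smul_comm,
        smul_mul_assoc, mul_one, one_mul]
      simp only [smul_add, smul_smul, mul_comm (x.2 * _) (y.2 * _)]
      abel }

theorem fockRep_L (t : ℂ) (n : ℤ) : fockRep t (L n) = HeisenbergFock.op t n := by
  change fockMap t (L n) = _
  simp [fockMap_apply]

theorem fockRep_C (t : ℂ) :
    fockRep t C = (1 - 12 * t ^ 2) • (1 : Module.End ℂ (MvPolynomial ℕ ℂ)) := by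
  change fockMap t C = _
  simp [fockMap_apply]

/-- The lowest weight vector of `M(c, 0)` is nonzero, because it is mapped to the vacuum of a Fock
space. -/
theorem one_notMem_vermaIdeal (c : ℂ) : (1 : U) ∉ vermaIdeal c 0 := by
  obtain ⟨t, ht⟩ : ∃ t : ℂ, 1 - 12 * t ^ 2 = c := by
    obtain ⟨t, ht⟩ := IsAlgClosed.exists_pow_nat_eq ((1 - c) / 12) (n := 2) two_pos
    exact ⟨t, by rw [ht]; ring⟩
  set φ : U →ₐ[ℂ] Module.End ℂ (MvPolynomial ℕ ℂ) :=
    UniversalEnvelopingAlgebra.lift ℂ (fockRep t) with hφ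
  have hL : ∀ n, φ (Lu n) = HeisenbergFock.op t n := fun n => by
    rw [hφ, Lu, UniversalEnvelopingAlgebra.lift_ι_apply, fockRep_L]
  have hC : φ Cu = c • 1 := by
    rw [hφ, Cu, UniversalEnvelopingAlgebra.lift_ι_apply, fockRep_C, ht]
  have h : ∀ u ∈ vermaIdeal c 0, φ u 1 = 0 := by
    intro u hu
    induction hu using Submodule.span_induction with
    | mem u hu =>
      rcases hu with ⟨n, hn, rfl⟩ | rfl | rfl
      · rw [hL, HeisenbergFock.op_one t n hn.le]
      · rw [map_sub, hL, map_zero, map_zero, sub_zero, HeisenbergFock.op_one t 0 le_rfl]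
      · rw [map_sub, hC, AlgHom.commutes, Algebra.algebraMap_eq_smul_one, sub_self,
          LinearMap.zero_apply]
    | zero => rw [map_zero, LinearMap.zero_apply]
    | add x y _ _ hx hy => rw [map_add, LinearMap.add_apply, hx, hy, add_zero]
    | smul r x _ hx => rw [smul_eq_mul, map_mul, Module.End.mul_apply, hx, map_zero]
  intro h1
  have := h 1 h1
  rw [map_one φ, Module.End.one_apply] at this
  exact one_ne_zero this

/-! ### Generators and relations of the enveloping algebra -/

theorem bracket_L_L (m n : ℤ) : ⁅L m, L n⁆ = genBracket m n := by
  rw [bracket_def, L_fst, L_fst, bracketMap_single, one_smul, one_smul]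

theorem bracket_C (x : Vir) : ⁅C, x⁆ = 0 := by
  rw [bracket_def, C_fst, map_zero, LinearMap.zero_apply]

theorem Lu_mul_Lu (m n : ℤ) :
    Lu m * Lu n = Lu n * Lu m + ((m : ℂ) - n) • Lu (m + n) +
      (if m + n = 0 then ((m : ℂ) ^ 3 - m) / 12 else 0) • Cu := by
  have h := LieHom.map_lie (UniversalEnvelopingAlgebra.ι ℂ (L := Vir)) (L m) (L n)
  rw [bracket_L_L, genBracket, map_add, map_smul, map_smul,
    LieRing.of_associative_ring_bracket] at h
  rw [add_assoc]
  exact (sub_eq_iff_eq_add'.1 h.symm)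

theorem Cu_mul_Lu (n : ℤ) : Cu * Lu n = Lu n * Cu := by
  have h := LieHom.map_lie (UniversalEnvelopingAlgebra.ι ℂ (L := Vir)) C (L n)
  rw [bracket_C, map_zero, LieRing.of_associative_ring_bracket] at h
  exact sub_eq_zero.1 h.symm

theorem eq_linearCombination_L_add_C (x : Vir) :
    x = Finsupp.linearCombination ℂ L x.1 + x.2 • C := by
  have h : ∀ f : ℤ →₀ ℂ, Finsupp.linearCombination ℂ L f = ((f, 0) : Vir) := by
    intro f
    induction f using Finsupp.induction_linear with
    | zero => simp; rfl
    | add f g hf hg =>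
      rw [map_add, hf, hg]
      exact Prod.ext rfl (add_zero _)
    | single n r =>
      rw [Finsupp.linearCombination_single]
      refine Prod.ext ?_ ?_
      · simp
      · simp
  rw [h]
  refine Prod.ext ?_ ?_
  · change x.1 = x.1 + x.2 • (0 : ℤ →₀ ℂ)
    rw [smul_zero, add_zero]
  · change x.2 = 0 + x.2 * 1
    rw [zero_add, mul_one]

/-- `U(Vir)` is generated as an algebra by the `L(n)` and the central element. -/
theorem adjoin_eq_top : Algebra.adjoin ℂ (Set.range Lu ∪ {Cu}) = ⊤ := by
  set A := Algebra.adjoin ℂ (Set.range Lu ∪ {Cu}) with hA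
  have hι : ∀ x : Vir, UniversalEnvelopingAlgebra.ι ℂ x ∈ A := by
    intro x
    rw [eq_linearCombination_L_add_C x, map_add, map_smul]
    refine A.add_mem ?_ (A.smul_mem (Algebra.subset_adjoin (Or.inr rfl)) _)
    rw [Finsupp.linearCombination_apply, Finsupp.sum, map_sum]
    refine A.sum_mem fun n _ => ?_
    rw [map_smul]
    exact A.smul_mem (Algebra.subset_adjoin (Or.inl ⟨n, rfl⟩)) _
  rw [eq_top_iff]
  rintro u -
  obtain ⟨t, rfl⟩ : ∃ t, UniversalEnvelopingAlgebra.mkAlgHom ℂ Vir t = u :=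
    RingCon.mkₐ_surjective _ u
  induction t using TensorAlgebra.induction with
  | algebraMap r => rw [AlgHom.commutes]; exact A.algebraMap_mem r
  | ι x => exact hι x
  | mul a b ha hb => rw [map_mul]; exact A.mul_mem ha hb
  | add a b ha hb => rw [map_add]; exact A.add_mem ha hb

/-! ### Weight vectors of Verma modules -/

variable (c h : ℂ)

/-- The lowest weight vector of `M(c, h)`, the image of `1 ∈ U(Vir)`. -/
def Verma.lowest : Verma c h := Submodule.Quotient.mk (1 : U)

theorem smul_lowest (u : U) : u • Verma.lowest c h = Submodule.Quotient.mk u := by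
  rw [Verma.lowest, ← Submodule.Quotient.mk_smul, smul_eq_mul, mul_one]

theorem Lu_smul_lowest (n : ℤ) (hn : 0 < n) : Lu n • Verma.lowest c h = 0 := by
  rw [smul_lowest, Submodule.Quotient.mk_eq_zero]
  exact Submodule.subset_span (Or.inl ⟨n, hn, rfl⟩)

theorem Lu_zero_smul_lowest : Lu 0 • Verma.lowest c h = h • Verma.lowest c h := by
  rw [← sub_eq_zero, ← algebraMap_smul U h, ← sub_smul, smul_lowest,
    Submodule.Quotient.mk_eq_zero]
  exact Submodule.subset_span (Or.inr (Or.inl rfl))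

theorem Cu_smul_lowest : Cu • Verma.lowest c h = c • Verma.lowest c h := by
  rw [← sub_eq_zero, ← algebraMap_smul U c, ← sub_smul, smul_lowest,
    Submodule.Quotient.mk_eq_zero]
  exact Submodule.subset_span (Or.inr (Or.inr rfl))

/-- `IsWord c h d v` says that `v = L(-k₁) ⋯ L(-kᵣ) v₀` for some `kᵢ > 0` with sum `d`, where `v₀`
is the lowest weight vector of `M(c, h)`. The `kᵢ` are not required to be ordered. -/
inductive IsWord : ℤ → Verma c h → Prop
  | lowest : IsWord 0 (Verma.lowest c h)
  | cons (k d : ℤ) (v : Verma c h) (hk : 0 < k) (hv : IsWord d v) : IsWord (d + k) (Lu (-k) • v)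

/-- The span of the words of degree `d`, which is zero for `d < 0`. -/
def wordSpan (d : ℤ) : Submodule ℂ (Verma c h) := Submodule.span ℂ {v | IsWord c h d v}

variable {c h}

theorem IsWord.nonneg {d : ℤ} {v : Verma c h} (hv : IsWord c h d v) : 0 ≤ d := by
  induction hv with
  | lowest => exact le_rfl
  | cons k d v hk _ ih => omega

theorem IsWord.eq_lowest {d : ℤ} {v : Verma c h} (hv : IsWord c h d v) (hd : d = 0) :
    v = Verma.lowest c h := by
  cases hv with
  | lowest => rfl
  | cons k d v hk hv => have := hv.nonneg; omega

theorem IsWord.Cu_smul {d : ℤ} {v : Verma c h} (hv : IsWord c h d v) : Cu • v = c • v := by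
  induction hv with
  | lowest => exact Cu_smul_lowest c h
  | cons k d v hk _ ih => rw [← mul_smul, Cu_mul_Lu, mul_smul, ih, smul_comm]

theorem IsWord.Lu_zero_smul {d : ℤ} {v : Verma c h} (hv : IsWord c h d v) :
    Lu 0 • v = (h + d) • v := by
  induction hv with
  | lowest => rw [Lu_zero_smul_lowest, Int.cast_zero, add_zero]
  | cons k d v hk _ ih =>
    rw [← mul_smul, Lu_mul_Lu, if_neg (by omega), zero_smul, add_zero, add_smul, mul_smul, ih,
      smul_comm _ (h + d : ℂ), smul_assoc, zero_add, ← add_smul]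
    congr 1
    push_cast
    ring

theorem IsWord.mem_wordSpan {d : ℤ} {v : Verma c h} (hv : IsWord c h d v) : v ∈ wordSpan c h d :=
  Submodule.subset_span hv

theorem Lu_neg_smul_mem_wordSpan {k d e : ℤ} (hk : 0 < k) (he : e = d + k) {v : Verma c h}
    (hv : v ∈ wordSpan c h d) : Lu (-k) • v ∈ wordSpan c h e := by
  subst he
  induction hv using Submodule.span_induction with
  | mem v hv => exact (IsWord.cons k d v hk hv).mem_wordSpan
  | zero => rw [smul_zero]; exact zero_mem _
  | add x y _ _ hx hy => rw [smul_add]; exact add_mem hx hy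
  | smul r x _ hx => rw [smul_comm]; exact Submodule.smul_mem _ _ hx

/-- Moving `L(m)` to the right through a word only leaves words. -/
theorem IsWord.Lu_smul_mem {d : ℤ} {v : Verma c h} (hv : IsWord c h d v) :
    ∀ m e : ℤ, e = d - m → Lu m • v ∈ wordSpan c h e := by
  suffices H : ∀ m e : ℤ, 0 ≤ m → e = d - m → Lu m • v ∈ wordSpan c h e by
    intro m e he
    rcases le_or_gt 0 m with hm | hm
    · exact H m e hm he
    · rw [← neg_neg m]
      exact Lu_neg_smul_mem_wordSpan (by omega) (by omega) hv.mem_wordSpan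
  induction hv with
  | lowest =>
    intro m e hm he
    rcases hm.eq_or_lt with rfl | hm
    · rw [Lu_zero_smul_lowest]
      exact Submodule.smul_mem _ _ (Submodule.subset_span (by rw [he]; exact IsWord.lowest))
    · rw [Lu_smul_lowest c h m hm]
      exact zero_mem _
  | cons k d v hk hv ih =>
    intro m e hm he
    rw [← mul_smul, Lu_mul_Lu, add_smul, add_smul, smul_assoc, smul_assoc, mul_smul, hv.Cu_smul]
    refine add_mem (add_mem ?_ (Submodule.smul_mem _ _ ?_)) ?_
    · exact Lu_neg_smul_mem_wordSpan hk (by omega) (ih m (d - m) hm rfl)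
    · rcases le_or_gt 0 (m + -k) with h0 | h0
      · exact ih _ _ h0 (by omega)
      · rw [← neg_neg (m + -k)]
        exact Lu_neg_smul_mem_wordSpan (by omega) (by omega) hv.mem_wordSpan
    · split_ifs with h0
      · have : e = d := by omega
        subst this
        exact Submodule.smul_mem _ _ (Submodule.smul_mem _ _ hv.mem_wordSpan)
      · rw [zero_smul]
        exact zero_mem _

variable (c h)

theorem span_isWord_eq_top : Submodule.span ℂ {v | ∃ d, IsWord c h d v} = ⊤ := by
  set S := Submodule.span ℂ {v | ∃ d, IsWord c h d v} with hS
  have hle : ∀ d, wordSpan c h d ≤ S := fun d => Submodule.span_mono fun v hv => ⟨d, hv⟩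
  have key : ∀ u : U, ∀ v ∈ S, u • v ∈ S := by
    intro u
    have hu : u ∈ Algebra.adjoin ℂ (Set.range Lu ∪ {Cu}) := adjoin_eq_top ▸ Algebra.mem_top
    induction hu using Algebra.adjoin_induction with
    | mem u hu =>
      intro v hv
      induction hv using Submodule.span_induction with
      | mem v hv =>
        obtain ⟨d, hv⟩ := hv
        rcases hu with ⟨n, rfl⟩ | rfl
        · exact hle _ (hv.Lu_smul_mem n _ rfl)
        · rw [hv.Cu_smul]
          exact S.smul_mem _ (hle d hv.mem_wordSpan)
      | zero => rw [smul_zero]; exact zero_mem _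
      | add x y _ _ hx hy => rw [smul_add]; exact add_mem hx hy
      | smul r x _ hx => rw [smul_comm]; exact S.smul_mem _ hx
    | algebraMap r => intro v hv; rw [algebraMap_smul]; exact S.smul_mem _ hv
    | add x y _ _ hx hy => intro v hv; rw [add_smul]; exact add_mem (hx v hv) (hy v hv)
    | mul x y _ _ hx hy => intro v hv; rw [mul_smul]; exact hx _ (hy v hv)
  rw [eq_top_iff]
  rintro v -
  obtain ⟨u, rfl⟩ := Submodule.Quotient.mk_surjective _ v
  rw [← smul_lowest]
  exact key u _ (Submodule.subset_span ⟨0, IsWord.lowest⟩)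

/-! ### Proper submodules and the irreducible quotient -/

/-- The sum of the weight spaces of `M(c, h)` other than the lowest one, given as the span of the
words of positive degree. -/
def positivePart : Submodule ℂ (Verma c h) := Submodule.span ℂ {v | ∃ d, 0 < d ∧ IsWord c h d v}

theorem exists_eq_smul_lowest_add (v : Verma c h) :
    ∃ t : ℂ, ∃ y ∈ positivePart c h, v = t • Verma.lowest c h + y := by
  have hv : v ∈ Submodule.span ℂ {v | ∃ d, IsWord c h d v} := by
    rw [span_isWord_eq_top]; trivial
  induction hv using Submodule.span_induction with
  | mem v hv =>
    obtain ⟨d, hv⟩ := hv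
    rcases hv.nonneg.eq_or_lt with hd | hd
    · exact ⟨1, 0, zero_mem _, by rw [hv.eq_lowest hd.symm, one_smul, add_zero]⟩
    · exact ⟨0, v, Submodule.subset_span ⟨d, hd, hv⟩, by rw [zero_smul, zero_add]⟩
  | zero => exact ⟨0, 0, zero_mem _, by simp⟩
  | add x x' _ _ hx hx' =>
    obtain ⟨t, y, hy, rfl⟩ := hx
    obtain ⟨t', y', hy', rfl⟩ := hx'
    exact ⟨t + t', y + y', add_mem hy hy', by rw [add_smul]; abel⟩
  | smul r x _ hx =>
    obtain ⟨t, y, hy, rfl⟩ := hx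
    exact ⟨r * t, r • y, Submodule.smul_mem _ _ hy, by rw [smul_add, mul_smul]⟩

theorem aeval_Lu_zero_smul {v : Verma c h} {r : ℂ} (hv : Lu 0 • v = r • v) (p : Polynomial ℂ) :
    Polynomial.aeval (Lu 0) p • v = p.eval r • v := by
  induction p using Polynomial.induction_on' with
  | add p q hp hq => rw [map_add, add_smul, hp, hq, Polynomial.eval_add, add_smul]
  | monomial n s =>
    have h1 : (Lu 0) ^ n • v = r ^ n • v := by
      induction n with
      | zero => simp
      | succ n ih => rw [pow_succ, mul_smul, hv, smul_comm, ih, ← mul_smul, pow_succ, mul_comm]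
    rw [Polynomial.aeval_monomial, Polynomial.eval_monomial, mul_smul, h1, algebraMap_smul,
      mul_smul]

/-- A vector of the positive part is annihilated by a polynomial in `L(0)` which is invertible at
the lowest weight. -/
theorem exists_aeval_smul_eq_zero {y : Verma c h} (hy : y ∈ positivePart c h) :
    ∃ p : Polynomial ℂ, Polynomial.aeval (Lu 0) p • y = 0 ∧ p.eval h ≠ 0 := by
  induction hy using Submodule.span_induction with
  | mem y hy =>
    obtain ⟨d, hd, hy⟩ := hy
    refine ⟨Polynomial.X - Polynomial.C (h + d), ?_, ?_⟩
    · rw [aeval_Lu_zero_smul c h hy.Lu_zero_smul]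
      simp
    · simp [hd.ne']
  | zero => exact ⟨1, smul_zero _, by simp⟩
  | add x y _ _ hx hy =>
    obtain ⟨p, hp, hp'⟩ := hx
    obtain ⟨q, hq, hq'⟩ := hy
    refine ⟨p * q, ?_, by rw [Polynomial.eval_mul]; exact mul_ne_zero hp' hq'⟩
    rw [smul_add, map_mul, mul_smul, mul_smul, hq, smul_zero, add_zero, ← mul_smul, ← map_mul,
      mul_comm, map_mul, mul_smul, hp, smul_zero]
  | smul r x _ hx =>
    obtain ⟨p, hp, hp'⟩ := hx
    exact ⟨p, by rw [smul_comm, hp, smul_zero], hp'⟩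

/-- An element of `N` with a nonzero component of lowest weight would put the lowest weight vector,
which generates `M(c, h)`, into `N`: apply a polynomial in `L(0)` that kills the other
components. -/
theorem mem_positivePart_of_ne_top {N : Submodule U (Verma c h)} (hN : N ≠ ⊤) {x : Verma c h}
    (hx : x ∈ N) : x ∈ positivePart c h := by
  obtain ⟨t, y, hy, rfl⟩ := exists_eq_smul_lowest_add c h x
  by_cases ht : t = 0
  · rwa [ht, zero_smul, zero_add]
  · obtain ⟨p, hp, hp'⟩ := exists_aeval_smul_eq_zero c h hy
    refine absurd (eq_top_iff.2 fun v _ => ?_) hN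
    have h1 := N.smul_mem (Polynomial.aeval (Lu 0) p) hx
    rw [smul_add, hp, add_zero, smul_comm, aeval_Lu_zero_smul c h (Lu_zero_smul_lowest c h)] at h1
    have h2 := (N.restrictScalars ℂ).smul_mem (t * p.eval h)⁻¹ h1
    rw [← mul_smul t, ← mul_smul, inv_mul_cancel₀ (mul_ne_zero ht hp'), one_smul] at h2
    obtain ⟨u, rfl⟩ := Submodule.Quotient.mk_surjective _ v
    rw [← smul_lowest]
    exact N.smul_mem u h2

theorem Irr.lowest_ne_zero (h1 : (1 : U) ∉ vermaIdeal c h) : Irr.lowest c h ≠ 0 := by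
  intro h0
  rw [Irr.lowest, Submodule.Quotient.mk_eq_zero, maxSubmodule, sSup_eq_iSup'] at h0
  have h2 : Verma.lowest c h ∈ positivePart c h := by
    refine Submodule.iSup_induction _ (motive := fun x => x ∈ positivePart c h) h0 ?_ ?_ ?_
    · exact fun N x hx => mem_positivePart_of_ne_top c h N.2 hx
    · exact zero_mem _
    · exact fun _ _ => add_mem
  obtain ⟨p, hp, hp'⟩ := exists_aeval_smul_eq_zero c h h2
  rw [aeval_Lu_zero_smul c h (Lu_zero_smul_lowest c h), smul_eq_zero, or_iff_right hp'] at hp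
  exact h1 ((Submodule.Quotient.mk_eq_zero _).1 hp)

theorem Irr.op_lowest (n : ℤ) (hn : 0 < n) : Irr.op c h n (Irr.lowest c h) = 0 :=
  congrArg (Submodule.Quotient.mk (p := maxSubmodule c h)) (Lu_smul_lowest c h n hn)

theorem Irr.op_zero_lowest : Irr.op c h 0 (Irr.lowest c h) = h • Irr.lowest c h :=
  congrArg (Submodule.Quotient.mk (p := maxSubmodule c h)) (Lu_zero_smul_lowest c h)

theorem Irr.op_two_op_neg_two_lowest :
    Irr.op c h 2 (Irr.op c h (-2) (Irr.lowest c h)) = (4 * h + c / 2) • Irr.lowest c h := by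
  refine congrArg (Submodule.Quotient.mk (p := maxSubmodule c h))
    (a₁ := Lu 2 • Lu (-2) • Verma.lowest c h) (a₂ := (4 * h + c / 2) • Verma.lowest c h) ?_
  rw [← mul_smul, Lu_mul_Lu, add_smul, add_smul, smul_assoc, smul_assoc, mul_smul,
    Lu_smul_lowest c h 2 two_pos, smul_zero, zero_add, add_neg_cancel, if_pos rfl,
    Lu_zero_smul_lowest, Cu_smul_lowest, ← mul_smul, ← mul_smul, ← add_smul]
  congr 1
  push_cast
  ring

end Vir

end

/-! ### The commutator formula and the second coefficient -/

/-- The commutator formula, the case `l = 0` of the Jacobi identity, for a nonnegative mode. -/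
theorem JacobiIdentity.commutator {Γ W₁ W₂ W₃ : Type*} [AddCommGroupWithOne Γ]
    [AddCommGroup W₁] [AddCommGroup W₂] [AddCommGroup W₃]
    {A₁ : ℤ → W₁ → W₁} {A₂ : ℤ → W₂ → W₂} {A₃ : ℤ → W₃ → W₃} {B : W₁ → Γ → W₂ → W₃}
    (hJ : JacobiIdentity A₁ A₂ A₃ B) (m : ℕ) (α : Γ) (w₁ : W₁) (w₂ : W₂) :
    A₃ m (B w₁ α w₂) - B w₁ α (A₂ m w₂) =
      ∑ i ∈ Finset.range (m + 1), m.choose i • B (A₁ i w₁) (α + m - i) w₂ := by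
  have h := hJ 0 m α w₁ w₂
  rw [finsum_eq_single _ 0, finsum_eq_sum_of_support_subset (s := Finset.range (m + 1))] at h
  · simpa [Ring.choose_natCast] using h
  · intro i hi
    rw [Finset.mem_coe, Finset.mem_range]
    by_contra hlt
    refine hi ?_
    simp [Ring.choose_natCast, Nat.choose_eq_zero_of_lt (show m < i by omega)]
  · intro i hi
    rw [Ring.choose_zero_pos ℤ (Nat.pos_of_ne_zero hi), mul_zero, zero_smul]

theorem mainTheorem7 (c h a : ℂ) (hc : c ≠ 0)
    (𝒱 : VertexOperatorAlgebra (Vir.Irr c 0)) (h𝒱 : IsVirasoroVOA 𝒱)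
    (M : 𝒱.WeakModule (Vir.Irr c h)) (hM : IsVirasoroModule M)
    (𝒴 : LogIntertwiner M M 𝒱.adjoint)
    (hlead : 𝒴.Y (Vir.Irr.lowest c h) 0 (-2 * h) (Vir.Irr.lowest c h) = Vir.Irr.lowest c 0)
    (hnext : 𝒴.Y (Vir.Irr.lowest c h) 0 (-2 * h + 2) (Vir.Irr.lowest c h) =
      a • Vir.Irr.op c 0 (-2) (Vir.Irr.lowest c 0)) :
    a = 2 * h / c := by
  have hne := Vir.Irr.lowest_ne_zero c 0 (Vir.one_notMem_vermaIdeal c)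
  have hM₀ : mode (M.Y 𝒱.conf) 0 = Vir.Irr.op c h (-1) := by
    rw [← hM (-1), neg_add_cancel]
  have hM₁ : mode (M.Y 𝒱.conf) 1 = Vir.Irr.op c h 0 := hM 0
  have hM₂ : mode (M.Y 𝒱.conf) 2 = Vir.Irr.op c h 1 := hM 1
  have hM₃ : mode (M.Y 𝒱.conf) 3 = Vir.Irr.op c h 2 := hM 2
  have hV₁ : mode (𝒱.adjoint.Y 𝒱.conf) 1 = Vir.Irr.op c 0 0 := h𝒱.mode_eq 0
  have hV₃ : mode (𝒱.adjoint.Y 𝒱.conf) 3 = Vir.Irr.op c 0 2 := h𝒱.mode_eq 2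
  have hd := 𝒴.derivative (Vir.Irr.lowest c h) 0 (-2 * h - 1)
  -- The bracket with `L(0)` at the leading power of `x` shows that the coefficient of
  -- `x^{-2h} log x` is `L(0) 𝟏 = 0`.
  have e₁ := (𝒴.jacobi 𝒱.conf 0).commutator 1 (2 * h - 1) (Vir.Irr.lowest c h) (Vir.Irr.lowest c h)
  -- The bracket with `L(2)` at the next power of `x` then determines `a`.
  have e₃ := (𝒴.jacobi 𝒱.conf 0).commutator 3 (2 * h - 3) (Vir.Irr.lowest c h) (Vir.Irr.lowest c h)
  simp only [Finset.sum_range_succ, Finset.sum_range_zero, Nat.cast_ofNat, Nat.cast_zero,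
    Nat.cast_one, hM₀, hM₁, hM₂, hM₃, hV₁, hV₃, zero_add, Vir.Irr.op_zero_lowest,
    Vir.Irr.op_lowest _ _ _ zero_lt_one, Vir.Irr.op_lowest _ _ _ zero_lt_two, map_zero, map_smul,
    Finsupp.zero_apply] at e₁ e₃ hd
  rw [show -2 * h - 1 + 1 = -2 * h by ring] at hd
  simp only [show -(2 * h - 1) - 1 = -2 * h by ring, show -(2 * h - 3) - 1 = -2 * h + 2 by ring,
    sub_zero, show -(2 * h - 1 + 1) - 1 = -2 * h - 1 by ring,
    show -(2 * h - 1 + 1 - 1) - 1 = -2 * h by ring,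
    show -(2 * h - 3 + 3) - 1 = -2 * h - 1 by ring,
    show -(2 * h - 3 + 3 - 1) - 1 = -2 * h by ring, hd, Finsupp.smul_apply, Pi.smul_apply,
    LinearMap.add_apply, LinearMap.smul_apply, Pi.zero_apply, LinearMap.zero_apply, hlead, hnext,
    map_smul, Vir.Irr.op_zero_lowest, Vir.Irr.op_two_op_neg_two_lowest, Nat.choose_zero_right,
    Nat.choose_self, Nat.choose_one_right, smul_zero, add_zero] at e₁ e₃
  set y := 𝒴.Y (Vir.Irr.lowest c h) 1 (-2 * h) (Vir.Irr.lowest c h)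
  set v := Vir.Irr.lowest c 0
  have hy : y = 0 := by
    linear_combination (norm := module) (-1 : ℂ) • e₁
  rw [hy] at e₃
  have key : (a * (c / 2) - h) • v = 0 := by
    linear_combination (norm := module) e₃
  rw [smul_eq_zero, or_iff_left hne] at key
  rw [eq_div_iff hc]
  linear_combination 2 * key
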